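/- Let $K$ be a field of characteristic $0$ (for instance $K=\mathbb{C}$) and let $\psi(y)=\sum_{k\ge1}c_ky^k\in K[[y]]$ and $y(z)=\sum_{k\ge1}s_kz^k\in K[[z]]$ be formal power series without constant term. Let $\hbar$ be a formal variable and define: - $\phi_m(y)\in K[[y,\hbar]]$ for $m\in\mathbb{Z}$ by $\phi_m(y)=\exp\bigl(\sum_{i=1}^{m}\psi\bigl(y+\tfrac{2i-m-1}{2}\hbar\bigr)\bigr)$ for $m>0$, $\phi_0(y)=1$, and $\phi_m(y)=\phi_{-m}(y)^{-1}$ for $m<0$; - $\mathcal{S}(t)=\dfrac{e^{t/2}-e^{-t/2}}{t}$, $\;L_0(v,y,\hbar)=\exp\Bigl(v\Bigl(\dfrac{\mathcal{S}(v\hbar\partial_y)}{\mathcal{S}(\hbar\partial_y)}-1\Bigr)\psi(y)\Bigr)$, and $L_r(v,y,\hbar)=\bigl(\partial_y+v\psi'(y)\bigr)^rL_0(v,y,\hbar)$ for $r\ge0$; these are power series in $y$ and $\hbar$ whose coefficients are polynomials in $v$; - $X=X(z)=z\,e^{-\psi(y(z))}$, $\;Q=\dfrac{z}{X}\dfrac{dX}{dz}$,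 and $D=X\dfrac{\partial}{\partial X}=\dfrac1Q\,z\dfrac{\partial}{\partial z}$. Let $H(u,z)=\sum_{k\ge0}\hbar^k\sum_{m\ge M_k}H_{k,m}(u)\,z^m$ be a power series in $\hbar$ whose coefficients are formal Laurent series in $z$ with coefficients $H_{k,m}\in K[u]$ polynomial in $u$ (in particular, $H$ may be a Laurent series in $z$ with coefficients in $K[u]$ or in $K[u][[\hbar]]$). Then $$\sum_{m=-\infty}^{\infty}\sum_{r=0}^{\infty}\partial_y^r\phi_m(y)\big|_{y=0}\;X^m\,[z^mu^r]\,e^{u\,y(z)}H(u,z)\;=\;\sum_{j,r=0}^{\infty}D^j\left(\frac{[v^j]L_r(v,y(z),\hbar)}{Q}\,[u^r]H(u,z)\right)$$ as power series in $\hbar$ with coefficients in $K((z))$, where $X=X(z)$ on the left-hand side and $[\cdot]$ denotes the extraction of a coefficient. Both sides are well-defined formal sums: for all $k$ and $n$, only finitely many terms on each side have a non-zero coefficient at $\hbar^kz^n$. -/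

import Mathlib

/-!
Formal variables and the rings in which the objects live (`K` is a field of characteristic zero):

* `PowerSeries K` for series in `y` (such as `ψ(y)`), in `z` (such as `y(z)`) or in `ħ`;
* `PowerSeries (PowerSeries R)` for `R⟦y⟧⟦ħ⟧`: the outer variable is `ħ`, the inner one is `y`;
  here `R = K` or `R = K[v]`;
* `PowerSeries (LaurentSeries R)` for `R((z))⟦ħ⟧`: the outer variable is `ħ`, the inner one
  is `z`; here `R = K` or `R = K[u]`.
-/

namespace PrincipalIdentity

noncomputable section

/-- The exponential `e^f = ∑ᵢ fⁱ / i!` of a series `f ∈ R⟦y⟧⟦ħ⟧` without constant term. As `fⁱ`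
has no monomials of total degree less than `i`, only `i ≤ k + n` contribute to `ħᵏ yⁿ`. -/
def formalExp {R : Type*} [CommRing R] [Algebra ℚ R] (f : PowerSeries (PowerSeries R)) :
    PowerSeries (PowerSeries R) :=
  PowerSeries.mk fun k => PowerSeries.mk fun n =>
    ∑ i ∈ Finset.range (k + n + 1),
      ((i.factorial : ℚ)⁻¹) • PowerSeries.coeff n (PowerSeries.coeff k (f ^ i))

/-- The derivative `∂_y` on `R⟦y⟧⟦ħ⟧`. -/
def dy {R : Type*} [CommRing R] (f : PowerSeries (PowerSeries R)) :
    PowerSeries (PowerSeries R) :=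
  PowerSeries.mk fun k => PowerSeries.derivative R (PowerSeries.coeff k f)

section

variable {K : Type*} [Field K]

/-- `f(y + a ħ) ∈ K⟦y⟧⟦ħ⟧`, by the binomial expansion of each `(y + a ħ)^N`. -/
def shift (a : K) (f : PowerSeries K) : PowerSeries (PowerSeries K) :=
  PowerSeries.mk fun k => PowerSeries.mk fun n =>
    ((n + k).choose k : K) * a ^ k * PowerSeries.coeff (n + k) f

variable [CharZero K]

/-- `exp (∑_{i=1}^m ψ(y + (2i - m - 1)/2 · ħ))`. -/
def phiNat (ψ : PowerSeries K) (m : ℕ) : PowerSeries (PowerSeries K) :=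
  formalExp (∑ i ∈ Finset.Icc 1 m, shift ((2 * (i : K) - (m : K) - 1) / 2) ψ)

/-- `φ_m(y) ∈ K⟦y⟧⟦ħ⟧` for `m ∈ ℤ`. -/
def phi (ψ : PowerSeries K) (m : ℤ) : PowerSeries (PowerSeries K) :=
  if 0 < m then phiNat ψ m.natAbs
  else if m = 0 then 1
  else Ring.inverse (phiNat ψ m.natAbs)

/-- `∂_y^r φ_m(y) |_{y=0} ∈ K⟦ħ⟧`. -/
def phiDerivZero (ψ : PowerSeries K) (m : ℤ) (r : ℕ) : PowerSeries K :=
  PowerSeries.map PowerSeries.constantCoeff (dy^[r] (phi ψ m))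

variable (K) in
/-- `S(t) = (e^{t/2} - e^{-t/2}) / t`. -/
def seriesS : PowerSeries K :=
  PowerSeries.mk fun n => PowerSeries.coeff (n + 1)
    (PowerSeries.rescale (1 / 2 : K) (PowerSeries.exp K) -
      PowerSeries.rescale (-1 / 2 : K) (PowerSeries.exp K))

variable (K) in
/-- `S(v t) / S(t) ∈ K[v]⟦t⟧`. -/
def ratioS : PowerSeries (Polynomial K) :=
  PowerSeries.rescale (Polynomial.X : Polynomial K)
      (PowerSeries.map Polynomial.C (seriesS K)) *
    PowerSeries.map Polynomial.C (seriesS K)⁻¹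

/-- For `A(t) = ∑ₖ aₖ tᵏ ∈ K[v]⟦t⟧`, the series `A(ħ ∂_y) f(y) = ∑ₖ aₖ ħᵏ ∂_yᵏ f(y)`
in `K[v]⟦y⟧⟦ħ⟧`. -/
def applyOp (A : PowerSeries (Polynomial K)) (f : PowerSeries K) :
    PowerSeries (PowerSeries (Polynomial K)) :=
  PowerSeries.mk fun k =>
    PowerSeries.C (PowerSeries.coeff k A) *
      PowerSeries.map Polynomial.C ((PowerSeries.derivative K)^[k] f)

variable (K) in
/-- The variable `v` as an element of `K[v]⟦y⟧⟦ħ⟧`. -/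
def varV : PowerSeries (PowerSeries (Polynomial K)) :=
  PowerSeries.C (PowerSeries.C Polynomial.X)

/-- `L_0(v, y, ħ) = exp (v (S(v ħ ∂_y) / S(ħ ∂_y) - 1) ψ(y))`. -/
def seriesL0 (ψ : PowerSeries K) : PowerSeries (PowerSeries (Polynomial K)) :=
  formalExp (varV K * applyOp (ratioS K - 1) ψ)

/-- `L_r(v, y, ħ) = (∂_y + v ψ'(y))^r L_0(v, y, ħ)`. -/
def seriesL (ψ : PowerSeries K) (r : ℕ) : PowerSeries (PowerSeries (Polynomial K)) :=
  (fun f => dy f + varV K *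
      PowerSeries.C (PowerSeries.map Polynomial.C (PowerSeries.derivative K ψ)) * f)^[r]
    (seriesL0 ψ)

/-- `[v^j] L_r(v, y(z), ħ)` as an element of `K((z))⟦ħ⟧`. -/
def coeffL (ψ y : PowerSeries K) (r j : ℕ) : PowerSeries (LaurentSeries K) :=
  PowerSeries.mk fun k =>
    HahnSeries.ofPowerSeries ℤ K (PowerSeries.subst y
      (PowerSeries.mk fun n =>
        (PowerSeries.coeff n (PowerSeries.coeff k (seriesL ψ r))).coeff j))

/-- `X(z) = z e^{-ψ(y(z))}` as an element of `K((z))`. -/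
def seriesX (ψ y : PowerSeries K) : LaurentSeries K :=
  HahnSeries.ofPowerSeries ℤ K
    (PowerSeries.X * PowerSeries.subst (-(PowerSeries.subst y ψ)) (PowerSeries.exp K))

/-- `Q = (z / X) dX/dz` as an element of `K((z))`. -/
def seriesQ (ψ y : PowerSeries K) : LaurentSeries K :=
  HahnSeries.single 1 1 / seriesX ψ y * LaurentSeries.derivative K (seriesX ψ y)

/-- `D = X ∂/∂X = Q⁻¹ z ∂/∂z` on `K((z))⟦ħ⟧`. -/
def opD (ψ y : PowerSeries K) (f : PowerSeries (LaurentSeries K)) :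
    PowerSeries (LaurentSeries K) :=
  PowerSeries.mk fun k =>
    (seriesQ ψ y)⁻¹ * (HahnSeries.single 1 1 *
      LaurentSeries.derivative K (PowerSeries.coeff k f))

/-- `e^{u y(z)}` as an element of `K[u]((z))`. -/
def expUY (y : PowerSeries K) : LaurentSeries (Polynomial K) :=
  HahnSeries.ofPowerSeries ℤ (Polynomial K)
    (PowerSeries.subst (PowerSeries.C Polynomial.X * PowerSeries.map Polynomial.C y)
      (PowerSeries.exp (Polynomial K)))

end

section

variable {K : Type*} [Field K]

/-- `[z^m u^r] G ∈ K⟦ħ⟧` for `G ∈ K[u]((z))⟦ħ⟧`. -/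
def coeffZU (m : ℤ) (r : ℕ) (G : PowerSeries (LaurentSeries (Polynomial K))) : PowerSeries K :=
  PowerSeries.mk fun k => ((PowerSeries.coeff k G).coeff m).coeff r

/-- `[u^r] G ∈ K((z))⟦ħ⟧` for `G ∈ K[u]((z))⟦ħ⟧`. -/
def coeffU (r : ℕ) (G : PowerSeries (LaurentSeries (Polynomial K))) :
    PowerSeries (LaurentSeries K) :=
  PowerSeries.mk fun k =>
    HahnSeries.map (PowerSeries.coeff k G) (Polynomial.lcoeff K r)

/-- The family `f` of elements of `K((z))⟦ħ⟧` has the formal sum `F`: each monomial `ħᵏ zⁿ`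
occurs in only finitely many members, and its coefficients there add up to that in `F`. -/
def HasFormalSum {ι : Type*} (f : ι → PowerSeries (LaurentSeries K))
    (F : PowerSeries (LaurentSeries K)) : Prop :=
  ∀ (k : ℕ) (n : ℤ),
    {i | (PowerSeries.coeff k (f i)).coeff n ≠ 0}.Finite ∧
      ∑ᶠ i, (PowerSeries.coeff k (f i)).coeff n = (PowerSeries.coeff k F).coeff n

end

section

variable {K : Type*} [Field K] [CharZero K]

/-- The term `∂_y^r φ_m(0) X^m [z^m u^r] (e^{u y(z)} H(u, z))`, with `X = X(z)`. -/
def lhsTerm (ψ y : PowerSeries K) (H : PowerSeries (LaurentSeries (Polynomial K)))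
    (m : ℤ) (r : ℕ) : PowerSeries (LaurentSeries K) :=
  PowerSeries.map HahnSeries.C
      (phiDerivZero ψ m r * coeffZU m r (PowerSeries.C (expUY y) * H)) *
    PowerSeries.C (seriesX ψ y ^ m)

/-- The term `D^j ([v^j] L_r(v, y(z), ħ) / Q · [u^r] H(u, z))`. -/
def rhsTerm (ψ y : PowerSeries K) (H : PowerSeries (LaurentSeries (Polynomial K)))
    (j r : ℕ) : PowerSeries (LaurentSeries K) :=
  (opD ψ y)^[j] (coeffL ψ y r j * PowerSeries.C (seriesQ ψ y)⁻¹ * coeffU r H)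

end

end

end PrincipalIdentity

/-! Two facts carry the identity. The first is that `φ_m(y) = e^{mψ(y)} L_0(m, y, ħ)`. By Taylor's
formula the exponent of `φ_m` is `∑ᵢ e^{(2i-m-1)ħ∂/2} ψ`, and this geometric sum equals `m
S(mħ∂)/S(ħ∂) ψ`. Differentiating `r` times turns `L_0` into `L_r` (`iterate_dy_phi`), so `∂_y^r φ_m`
is `e^{mψ}` times a series whose coefficients are polynomial in `m`. The second is Lagrange
inversion in residue form (`hasFinSum_lagrange`): `∑ₘ mʲ Xᵐ [z⁰](X^{-m} Q F) = Dʲ F`. Indeed `D Xᵐ =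
m Xᵐ`, and the powers of `X` are dual to one another under `[z⁰](X^{-m} Q X^a)`.

For `H = c u^s z^a`, summing over `r` is a Taylor expansion (`hasFinSum_taylor`) and leaves `∑ₘ Xᵐ
[z^{m-a}] c (∂^s φ_m)(y(z))`. Since `e^{mψ(y(z))} = z^m X^{-m}`, the coefficient is `∑ⱼ mʲ
[z⁰](X^{-m} c z^a [v^j]L_s)`. Lagrange inversion with `F = [v^j]L_s · c z^a / Q` then gives the
right-hand side (`sumsAgree_single`). A general `H` is treated separately for each power of `ħ`.
Both sides are additive in `H`, and terms of `H` beyond `z^n` do not affect `z^n`, so finitely many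
monomials suffice (`sumsAgree`). -/

namespace PrincipalIdentity

noncomputable section

open PowerSeries

/-! ### The exponential on `R⟦y⟧⟦ħ⟧` and its functional equation. -/

section FormalExp

variable {R : Type*} [CommRing R]

/-- If `f` and `g` vanish in total degree below `a` and `b`, then `f * g` vanishes in total degree
below `a + b`. -/
theorem coeff_coeff_mul_eq_zero {f g : PowerSeries (PowerSeries R)} {a b : ℕ}
    (hf : ∀ k n, k + n < a → coeff n (coeff k f) = 0)
    (hg : ∀ k n, k + n < b → coeff n (coeff k g) = 0) {k n : ℕ} (h : k + n < a + b) :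
    coeff n (coeff k (f * g)) = 0 := by
  rw [coeff_mul, map_sum]
  refine Finset.sum_eq_zero fun p hp => ?_
  rw [coeff_mul]
  refine Finset.sum_eq_zero fun q hq => ?_
  rw [Finset.HasAntidiagonal.mem_antidiagonal] at hp hq
  by_cases h1 : p.1 + q.1 < a
  · rw [hf _ _ h1, zero_mul]
  · rw [hg _ _ (by omega), mul_zero]

variable (R) in
/-- The ideal of series in `R⟦y⟧⟦ħ⟧` without monomials of total degree less than `N`. -/
def degIdeal (N : ℕ) : Ideal (PowerSeries (PowerSeries R)) where
  carrier := {f | ∀ k n, k + n < N → coeff n (coeff k f) = 0}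
  zero_mem' := by simp
  add_mem' := fun {f g} hf hg k n h => by simp [hf k n h, hg k n h]
  smul_mem' := fun c f hf k n h => by
    rw [smul_eq_mul]
    exact coeff_coeff_mul_eq_zero (a := 0) (by simp) hf (by simpa using h)

theorem mem_degIdeal {N : ℕ} {f : PowerSeries (PowerSeries R)} :
    f ∈ degIdeal R N ↔ ∀ k n, k + n < N → coeff n (coeff k f) = 0 := Iff.rfl

theorem pow_mem_degIdeal {f : PowerSeries (PowerSeries R)}
    (hf : constantCoeff (constantCoeff f) = 0) (i : ℕ) : f ^ i ∈ degIdeal R i := by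
  induction i with
  | zero => simp [mem_degIdeal]
  | succ i ih =>
    intro k n h
    rw [pow_succ]
    refine coeff_coeff_mul_eq_zero ih (b := 1) (fun k n h => ?_) h
    obtain ⟨rfl, rfl⟩ : k = 0 ∧ n = 0 := by omega
    simpa using hf

/-- The ideals `degIdeal R N` intersect in zero, so identities may be checked in the quotients,
where a series without constant term is nilpotent. -/
theorem eq_of_forall_mk_degIdeal {f g : PowerSeries (PowerSeries R)}
    (h : ∀ N, Ideal.Quotient.mk (degIdeal R N) f = Ideal.Quotient.mk (degIdeal R N) g) :
    f = g := by
  ext k n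
  have := (Ideal.Quotient.eq.1 (h (k + n + 1))) k n (by omega)
  rwa [map_sub, map_sub, sub_eq_zero] at this

theorem isNilpotent_mk_degIdeal {f : PowerSeries (PowerSeries R)}
    (hf : constantCoeff (constantCoeff f) = 0) (N : ℕ) :
    IsNilpotent (Ideal.Quotient.mk (degIdeal R N) f) :=
  ⟨N, by rw [← map_pow]; exact Ideal.Quotient.eq_zero_iff_mem.2 (pow_mem_degIdeal hf N)⟩

variable [Algebra ℚ R]

theorem coeff_formalExp {f : PowerSeries (PowerSeries R)}
    (hf : constantCoeff (constantCoeff f) = 0) {k n N : ℕ} (h : k + n < N) :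
    coeff n (coeff k (formalExp f)) =
      ∑ i ∈ Finset.range N, ((i.factorial : ℚ)⁻¹) • coeff n (coeff k (f ^ i)) := by
  rw [formalExp, coeff_mk, coeff_mk]
  refine Finset.sum_subset (Finset.range_mono (by omega)) fun i _ hi => ?_
  rw [pow_mem_degIdeal hf i k n (by simpa using hi), smul_zero]

/-- Powers `f ^ i` with `i ≥ N` vanish modulo `degIdeal R N`, so the truncation of the exponential
at a bound depending on the coefficient is harmless. The functional equation is then inherited from
`IsNilpotent.exp`. -/
theorem mk_formalExp {f : PowerSeries (PowerSeries R)}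
    (hf : constantCoeff (constantCoeff f) = 0) (N : ℕ) :
    Ideal.Quotient.mk (degIdeal R N) (formalExp f) =
      IsNilpotent.exp (Ideal.Quotient.mk (degIdeal R N) f) := by
  have h0 : Ideal.Quotient.mk (degIdeal R N) f ^ N = 0 := by
    rw [← map_pow]
    exact Ideal.Quotient.eq_zero_iff_mem.2 (pow_mem_degIdeal hf N)
  rw [IsNilpotent.exp_eq_sum h0]
  have : ∑ i ∈ Finset.range N, ((i.factorial : ℚ)⁻¹) • Ideal.Quotient.mk (degIdeal R N) f ^ i =
      Ideal.Quotient.mk (degIdeal R N)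
        (∑ i ∈ Finset.range N, ((i.factorial : ℚ)⁻¹) • f ^ i) := by
    rw [map_sum]
    refine Finset.sum_congr rfl fun i _ => ?_
    rw [map_rat_smul, map_pow]
  rw [this, Ideal.Quotient.eq]
  intro k n h
  rw [map_sub, map_sub, coeff_formalExp hf h, map_sum, map_sum, sub_eq_zero]
  refine Finset.sum_congr rfl fun i _ => ?_
  rw [map_rat_smul, map_rat_smul]

theorem formalExp_add {f g : PowerSeries (PowerSeries R)}
    (hf : constantCoeff (constantCoeff f) = 0) (hg : constantCoeff (constantCoeff g) = 0) :
    formalExp (f + g) = formalExp f * formalExp g := by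
  refine eq_of_forall_mk_degIdeal fun N => ?_
  rw [map_mul, mk_formalExp hf, mk_formalExp hg, mk_formalExp (by simp [hf, hg]), map_add]
  exact IsNilpotent.exp_add_of_commute (Commute.all _ _) (isNilpotent_mk_degIdeal hf N)
    (isNilpotent_mk_degIdeal hg N)

theorem formalExp_zero : formalExp (0 : PowerSeries (PowerSeries R)) = 1 := by
  refine eq_of_forall_mk_degIdeal fun N => ?_
  rw [mk_formalExp (by simp), map_zero, map_one, IsNilpotent.exp_zero]

theorem map_formalExp {S : Type*} [CommRing S] [Algebra ℚ S] (φ : R →+* S)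
    (f : PowerSeries (PowerSeries R)) :
    PowerSeries.map (PowerSeries.map φ) (formalExp f) =
      formalExp (PowerSeries.map (PowerSeries.map φ) f) := by
  ext k n
  simp only [formalExp, coeff_map, coeff_mk, map_sum, ← map_pow, map_rat_smul]

/-- Links the two exponentials in use, so that `exp_subst_add` can be deduced from `formalExp_add`.
-/
theorem formalExp_C {f : PowerSeries R} (hf : constantCoeff f = 0) :
    formalExp (C f) = C (subst f (exp R)) := by
  have hf' : constantCoeff (constantCoeff (C f)) = 0 := by simpa using hf
  ext k n
  rw [coeff_formalExp hf' (Nat.lt_succ_self _), coeff_C]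
  split_ifs with hk
  · subst hk
    rw [coeff_subst' (HasSubst.of_constantCoeff_zero' hf),
      finsum_eq_sum_of_support_subset (s := Finset.range (0 + n).succ)]
    · refine Finset.sum_congr rfl fun i _ => ?_
      rw [← map_pow, coeff_zero_C, coeff_exp, one_div, algebraMap_smul]
    · intro i hi
      by_contra h
      apply hi
      have := pow_mem_degIdeal hf' i 0 n (by simpa using h)
      rw [← map_pow, coeff_zero_C] at this
      simp [this]
  · rw [map_zero]
    refine Finset.sum_eq_zero fun i _ => ?_
    rw [← map_pow, coeff_C, if_neg hk, map_zero, smul_zero]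

theorem exp_subst_add {f g : PowerSeries R} (hf : constantCoeff f = 0)
    (hg : constantCoeff g = 0) :
    subst (f + g) (exp R) = subst f (exp R) * subst g (exp R) := by
  apply PowerSeries.C_injective
  rw [map_mul, ← formalExp_C hf, ← formalExp_C hg, ← formalExp_C (by simp [hf, hg]), map_add,
    formalExp_add (by simpa using hf) (by simpa using hg)]

theorem exp_subst_zero : subst (0 : PowerSeries R) (exp R) = 1 := by
  apply PowerSeries.C_injective
  rw [← formalExp_C (by simp), map_zero, formalExp_zero, map_one]

/-- When `ħ` divides `f`, the number of summands depends on `k` only and not on the power of `y`.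
This uniformity yields the degree bound in `v` for `L_0`. -/
theorem coeff_formalExp_of_constantCoeff_eq_zero {f : PowerSeries (PowerSeries R)}
    (hf : constantCoeff f = 0) (k : ℕ) :
    coeff k (formalExp f) =
      ∑ i ∈ Finset.range (k + 1), ((i.factorial : ℚ)⁻¹) • coeff k (f ^ i) := by
  ext n
  rw [coeff_formalExp (by simp [hf]) (Nat.lt_succ_self _), map_sum]
  simp only [map_rat_smul]
  symm
  refine Finset.sum_subset (Finset.range_mono (by omega)) fun i _ hi => ?_
  have : X ^ i ∣ f ^ i := pow_dvd_pow_of_dvd (X_dvd_iff.2 hf) i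
  rw [X_pow_dvd_iff.1 this k (by simpa using hi), map_zero, smul_zero]

end FormalExp

/-! ### The derivation `∂_y`, coefficientwise in `ħ`. -/

section Derivative

variable {R : Type*} [CommRing R]

theorem coeff_dy (f : PowerSeries (PowerSeries R)) (k : ℕ) :
    coeff k (dy f) = PowerSeries.derivative R (coeff k f) := by
  rw [dy, coeff_mk]

theorem coeff_iterate_dy (f : PowerSeries (PowerSeries R)) (k r : ℕ) :
    coeff k (dy^[r] f) = (PowerSeries.derivative R)^[r] (coeff k f) := by
  induction r generalizing f with
  | zero => rfl
  | succ r ih => rw [Function.iterate_succ_apply, Function.iterate_succ_apply, ih, coeff_dy]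

theorem dy_C_mul (g : PowerSeries R) (f : PowerSeries (PowerSeries R)) :
    dy (C g * f) = C g * dy f + C (PowerSeries.derivative R g) * f := by
  ext1 k
  simp only [coeff_dy, map_add, coeff_C_mul, Derivation.leibniz, smul_eq_mul]
  ring

theorem dy_map {S : Type*} [CommRing S] (φ : R →+* S) (f : PowerSeries (PowerSeries R)) :
    dy (PowerSeries.map (PowerSeries.map φ) f) = PowerSeries.map (PowerSeries.map φ) (dy f) := by
  ext k n
  simp [coeff_dy, coeff_derivative]

end Derivative

/-! ### Factorization of `φ_m` and its derivatives through `L_r` at `v = m`. -/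

section Phi

variable {K : Type*} [Field K] [CharZero K]

theorem constantCoeff_rescale_apply {R : Type*} [CommRing R] (a : R) (f : PowerSeries R) :
    constantCoeff (rescale a f) = constantCoeff f := by
  rw [← coeff_zero_eq_constantCoeff_apply, coeff_rescale, pow_zero, one_mul,
    coeff_zero_eq_constantCoeff_apply]

theorem X_mul_seriesS : X * seriesS K = rescale (1 / 2 : K) (exp K) - rescale (-1 / 2) (exp K) := by
  ext n
  cases n with
  | zero => simp [constantCoeff_rescale_apply]
  | succ n => rw [coeff_succ_X_mul, seriesS, coeff_mk]

theorem constantCoeff_seriesS : constantCoeff (seriesS K) = 1 := by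
  rw [← coeff_zero_eq_constantCoeff_apply, seriesS, coeff_mk]
  simp [coeff_rescale, coeff_exp]
  norm_num

theorem map_ratioS_mul (m : K) :
    PowerSeries.map (Polynomial.evalRingHom m) (ratioS K) * seriesS K =
      rescale m (seriesS K) := by
  have h : (seriesS K)⁻¹ * seriesS K = 1 :=
    PowerSeries.inv_mul_cancel _ (by rw [constantCoeff_seriesS]; exact one_ne_zero)
  have e (f : PowerSeries K) :
      PowerSeries.map (Polynomial.evalRingHom m) (PowerSeries.map Polynomial.C f) = f := by
    ext n; simp
  have e' (f : PowerSeries K) : PowerSeries.map (Polynomial.evalRingHom m)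
      (rescale Polynomial.X (PowerSeries.map Polynomial.C f)) = rescale m f := by
    ext n; simp [coeff_rescale]; exact mul_comm _ _
  rw [ratioS, map_mul, e, e', mul_assoc, h, mul_one]

theorem constantCoeff_ratioS : constantCoeff (ratioS K) = 1 := by
  rw [ratioS, map_mul, constantCoeff_rescale_apply]
  simp only [← coeff_zero_eq_constantCoeff_apply, coeff_map]
  simp [constantCoeff_seriesS]

theorem X_mul_rescale_seriesS (m : K) :
    X * (C m * rescale m (seriesS K)) =
      rescale (m / 2) (exp K) - rescale (-m / 2) (exp K) := by
  have h := congrArg (rescale m) (X_mul_seriesS (K := K))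
  rw [map_mul, rescale_X, map_sub, rescale_rescale, rescale_rescale] at h
  rw [← mul_assoc, mul_comm X, h]
  congr 3 <;> ring

/-- After multiplication by `t S(t) = e^{t/2} - e^{-t/2}`, the sum of exponentials telescopes to
`e^{mt/2} - e^{-mt/2} = t m S(mt)`. -/
theorem C_mul_map_ratioS_natCast (m : ℕ) :
    C (m : K) * PowerSeries.map (Polynomial.evalRingHom (m : K)) (ratioS K) =
      ∑ i ∈ Finset.Icc 1 m, rescale ((2 * (i : K) - m - 1) / 2) (exp K) := by
  have hS : seriesS K ≠ 0 := fun h => by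
    simpa [h] using (constantCoeff_seriesS (K := K))
  apply mul_right_cancel₀ hS
  apply mul_left_cancel₀ (X_ne_zero (R := K))
  rw [mul_assoc, map_ratioS_mul, X_mul_rescale_seriesS, ← mul_assoc, mul_comm X, mul_assoc,
    X_mul_seriesS, Finset.sum_mul]
  simp only [mul_sub, exp_mul_exp_eq_exp_add]
  have := Finset.sum_range_sub (fun i : ℕ => rescale ((2 * (i : K) - m) / 2) (exp K)) m
  rw [← Finset.Ico_add_one_right_eq_Icc, Finset.sum_Ico_eq_sum_range]
  convert this.symm using 1
  · congr 3 <;> push_cast <;> ring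
  · refine Finset.sum_congr rfl fun i _ => ?_
    congr 3 <;> push_cast <;> ring

/-- `t m S(mt) = e^{mt/2} - e^{-mt/2}` is odd in `m`. This makes the formula for `φ_m` compatible
with `φ_{-m} = φ_m⁻¹`. -/
theorem C_neg_mul_map_ratioS_neg (m : K) :
    C (-m) * PowerSeries.map (Polynomial.evalRingHom (-m)) (ratioS K) =
      -(C m * PowerSeries.map (Polynomial.evalRingHom m) (ratioS K)) := by
  have hS : seriesS K ≠ 0 := fun h => by
    simpa [h] using (constantCoeff_seriesS (K := K))
  apply mul_right_cancel₀ hS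
  apply mul_left_cancel₀ (X_ne_zero (R := K))
  rw [neg_mul, mul_neg, mul_assoc, mul_assoc, map_ratioS_mul, map_ratioS_mul,
    X_mul_rescale_seriesS, X_mul_rescale_seriesS, neg_neg, neg_sub]

variable (ψ : PowerSeries K)

/-- Evaluation of the coefficients at `v = m`. -/
def evalV (m : K) :
    PowerSeries (PowerSeries (Polynomial K)) →+* PowerSeries (PowerSeries K) :=
  PowerSeries.map (PowerSeries.map (Polynomial.evalRingHom m))

/-- The series `v (S(v ħ ∂_y) / S(ħ ∂_y)) ψ(y)` at `v = m`. -/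
def phiExponent (m : K) : PowerSeries (PowerSeries K) :=
  C (C m * ψ) + evalV m (varV K * applyOp (ratioS K - 1) ψ)

theorem coeff_phiExponent (m : K) (k : ℕ) :
    coeff k (phiExponent ψ m) =
      C (coeff k (C m * PowerSeries.map (Polynomial.evalRingHom m) (ratioS K))) *
        (PowerSeries.derivative K)^[k] ψ := by
  have e (f : PowerSeries K) :
      PowerSeries.map (Polynomial.evalRingHom m) (PowerSeries.map Polynomial.C f) = f := by
    ext n; simp
  rw [phiExponent, evalV, map_add, coeff_map, varV, coeff_C_mul, applyOp, coeff_mk,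
    map_mul (PowerSeries.map _), map_mul (PowerSeries.map _), e, map_C, map_C, coeff_C_mul, coeff_map, map_sub, map_sub, coeff_C, coeff_one]
  -- For `k = 0` the summand `mψ` of `phiExponent` cancels the `-1` in the exponent of `L_0`; for `k
  -- > 0` neither contributes.
  split_ifs with h
  · subst h
    simp
    ring
  · simp
    ring

theorem phiExponent_neg (m : K) : phiExponent ψ (-m) = -phiExponent ψ m := by
  ext1 k
  rw [map_neg, coeff_phiExponent, coeff_phiExponent, C_neg_mul_map_ratioS_neg, map_neg, map_neg,
    neg_mul]

/-- Taylor's formula `f(y + aħ) = e^{aħ∂} f(y)`. -/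
theorem coeff_shift (a : K) (f : PowerSeries K) (k : ℕ) :
    coeff k (shift a f) =
      C (coeff k (rescale a (exp K))) * (PowerSeries.derivative K)^[k] f := by
  ext n
  have h : (k.factorial : K) ≠ 0 := by exact_mod_cast k.factorial_ne_zero
  rw [shift, coeff_mk, coeff_mk, coeff_C_mul, coeff_iterate_derivative, coeff_rescale, coeff_exp,
    Nat.ascFactorial_eq_factorial_mul_choose]
  simp
  field_simp

theorem sum_shift (m : ℕ) :
    ∑ i ∈ Finset.Icc 1 m, shift ((2 * (i : K) - (m : K) - 1) / 2) ψ = phiExponent ψ m := by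
  ext1 k
  rw [coeff_phiExponent, C_mul_map_ratioS_natCast, map_sum, map_sum, map_sum, Finset.sum_mul]
  simp only [coeff_shift]

variable {ψ}

theorem constantCoeff_phiExponent (hψ : constantCoeff ψ = 0) (m : K) :
    constantCoeff (constantCoeff (phiExponent ψ m)) = 0 := by
  rw [← coeff_zero_eq_constantCoeff_apply (phiExponent ψ m), coeff_phiExponent]
  simp [hψ]

theorem phi_eq_formalExp (hψ : constantCoeff ψ = 0) (m : ℤ) :
    phi ψ m = formalExp (phiExponent ψ (m : K)) := by
  have hn : ∀ n : ℕ, phiNat ψ n = formalExp (phiExponent ψ (n : K)) := fun n => by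
    rw [phiNat, sum_shift]
  rcases lt_trichotomy 0 m with h | h | h
  · rw [phi, if_pos h, hn]
    congr 2
    rw [← Int.cast_natCast m.natAbs, Int.natCast_natAbs, abs_of_pos h]
  · subst h
    have : phiExponent ψ ((0 : ℤ) : K) = 0 := by
      ext1 k
      rw [coeff_phiExponent]
      simp
    rw [this, formalExp_zero, phi]
    simp
  · have hm : ((m.natAbs : ℕ) : K) = -m := by
      rw [← Int.cast_natCast m.natAbs, Int.natCast_natAbs, abs_of_neg h, Int.cast_neg]
    rw [phi, if_neg (by omega), if_neg (by omega), hn, hm, phiExponent_neg]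
    -- `Ring.inverse` is meaningful only on units, so an explicit inverse is exhibited.
    have h1 : formalExp (-phiExponent ψ (m : K)) * formalExp (phiExponent ψ (m : K)) = 1 := by
      rw [← formalExp_add (by simp [constantCoeff_phiExponent hψ])
        (constantCoeff_phiExponent hψ _), neg_add_cancel, formalExp_zero]
    rw [← mul_one (Ring.inverse _), ← h1, ← mul_assoc,
      Ring.inverse_mul_cancel _ (IsUnit.of_mul_eq_one _ h1), one_mul]

/-- `S(vt)/S(t)` has constant term `1`, so the exponent of `L_0` is divisible by `ħ`. -/
theorem constantCoeff_seriesL0_exponent :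
    constantCoeff (varV K * applyOp (ratioS K - 1) ψ) = 0 := by
  rw [map_mul, ← coeff_zero_eq_constantCoeff_apply (applyOp _ _), applyOp, coeff_mk, map_sub,
    coeff_zero_eq_constantCoeff_apply, constantCoeff_ratioS]
  simp

/-- `φ_m(y) = e^{m ψ(y)} L_0(m, y, ħ)`. -/
theorem phi_eq_mul_seriesL0 (hψ : constantCoeff ψ = 0) (m : ℤ) :
    phi ψ m = C (subst (C (m : K) * ψ) (exp K)) * evalV (m : K) (seriesL0 ψ) := by
  rw [phi_eq_formalExp hψ, phiExponent, formalExp_add (by simp [hψ]), formalExp_C (by simp [hψ]),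
    evalV, ← map_formalExp, seriesL0]
  simp only [evalV, ← coeff_zero_eq_constantCoeff_apply, coeff_map]
  rw [coeff_zero_eq_constantCoeff_apply, coeff_zero_eq_constantCoeff_apply,
    constantCoeff_seriesL0_exponent]
  simp

theorem derivative_exp_subst {f : PowerSeries K} (hf : constantCoeff f = 0) :
    PowerSeries.derivative K (subst f (exp K)) =
      subst f (exp K) * PowerSeries.derivative K f := by
  rw [derivative_subst (HasSubst.of_constantCoeff_zero' hf), derivative_exp]

theorem seriesL_succ (ψ : PowerSeries K) (r : ℕ) :
    seriesL ψ (r + 1) = dy (seriesL ψ r) + varV K *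
      C (PowerSeries.map Polynomial.C (PowerSeries.derivative K ψ)) * seriesL ψ r :=
  Function.iterate_succ_apply' _ _ _

/-- `∂_y^r φ_m(y) = e^{m ψ(y)} L_r(m, y, ħ)`. -/
theorem iterate_dy_phi (hψ : constantCoeff ψ = 0) (m : ℤ) (r : ℕ) :
    dy^[r] (phi ψ m) = C (subst (C (m : K) * ψ) (exp K)) * evalV (m : K) (seriesL ψ r) := by
  have e (f : PowerSeries K) : PowerSeries.map (Polynomial.evalRingHom (m : K))
      (PowerSeries.map Polynomial.C f) = f := by
    ext n; simp
  induction r with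
  | zero => exact phi_eq_mul_seriesL0 hψ m
  | succ r ih =>
    rw [Function.iterate_succ_apply', ih, seriesL_succ, dy_C_mul, derivative_exp_subst (by simp [hψ]), evalV, dy_map]
    simp only [map_add, map_mul, varV, PowerSeries.map_C, e, Derivation.leibniz, derivative_C]
    simp
    ring

end Phi

/-! ### Sums of families with finite support. -/

section FinSum

variable {ι κ M : Type*} [AddCommMonoid M]

/-- The family `f` has finite support and sum `s`. -/
def HasFinSum (f : ι → M) (s : M) : Prop :=
  f.support.Finite ∧ ∑ᶠ i, f i = s

theorem HasFinSum.add {f g : ι → M} {s t : M} (hf : HasFinSum f s) (hg : HasFinSum g t) :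
    HasFinSum (fun i => f i + g i) (s + t) :=
  ⟨(hf.1.union hg.1).subset (Function.support_add f g), by
    rw [finsum_add_distrib hf.1 hg.1, hf.2, hg.2]⟩

theorem hasFinSum_zero : HasFinSum (fun _ : ι => (0 : M)) 0 := by
  constructor <;> simp

theorem HasFinSum.sum (t : Finset κ) {f : κ → ι → M} {s : κ → M}
    (h : ∀ j ∈ t, HasFinSum (f j) (s j)) :
    HasFinSum (fun i => ∑ j ∈ t, f j i) (∑ j ∈ t, s j) := by
  classical
  induction t using Finset.induction_on with
  | empty => simpa using hasFinSum_zero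
  | insert a t ha ih =>
    simp only [Finset.sum_insert ha]
    exact (h a (by simp)).add (ih fun j hj => h j (by simp [hj]))

theorem HasFinSum.mul_right {R : Type*} [Field R] {f : ι → R} {s : R} (h : HasFinSum f s)
    (c : R) : HasFinSum (fun i => f i * c) (s * c) :=
  ⟨h.1.subset fun i hi h0 => hi (by simp only [h0, zero_mul]), by rw [← h.2, finsum_mul]⟩

theorem hasFinSum_of_finset (t : Finset ι) {f : ι → M} (h : ∀ i ∉ t, f i = 0) :
    HasFinSum f (∑ i ∈ t, f i) := by
  have : f.support ⊆ t := fun i hi => by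
    by_contra h'
    exact hi (h i h')
  exact ⟨t.finite_toSet.subset this, finsum_eq_sum_of_support_subset f this⟩

/-- Joint finiteness is a separate hypothesis: finiteness on each fibre and of the sums over the
fibres does not imply it, because of cancellation. -/
theorem HasFinSum.prod {f : ι × κ → M} {g : ι → M} {s : M} (hf : f.support.Finite)
    (h : ∀ i, HasFinSum (fun j => f (i, j)) (g i)) (hg : HasFinSum g s) : HasFinSum f s :=
  ⟨hf, by rw [finsum_curry f hf, ← hg.2]; exact finsum_congr fun i => (h i).2⟩

end FinSum

/-! ### Laurent series and the Euler operator `z d/dz`. -/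

section Laurent

variable {K : Type*} [Field K]

/-- If `f` and `g` vanish below `a` and `b`, then `f * g` vanishes below `a + b`. -/
theorem coeff_mul_eq_zero_of_lt {f g : LaurentSeries K} {a b : ℤ} (hf : ∀ i < a, f.coeff i = 0)
    (hg : ∀ i < b, g.coeff i = 0) : ∀ i < a + b, (f * g).coeff i = 0 := by
  intro i hi
  rw [HahnSeries.coeff_mul]
  refine Finset.sum_eq_zero fun p hp => ?_
  rw [Finset.mem_antidiagonal] at hp
  by_cases h : p.1 < a
  · rw [hf _ h, zero_mul]
  · rw [hg _ (by omega), mul_zero]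

theorem coeff_ofPowerSeries_of_neg {R : Type*} [CommRing R] (f : PowerSeries R) :
    ∀ i < 0, (HahnSeries.ofPowerSeries ℤ R f).coeff i = 0 := by
  intro i hi
  rw [PowerSeries.coeff_coe, if_pos hi]

theorem coeff_ofPowerSeries_natCast {R : Type*} [CommRing R] (f : PowerSeries R) (n : ℕ) :
    (HahnSeries.ofPowerSeries ℤ R f).coeff n = PowerSeries.coeff n f := by
  simp

/-- The coefficients of `z d/dz f`. -/
theorem coeff_single_mul_derivative (f : LaurentSeries K) (n : ℤ) :
    (HahnSeries.single 1 1 * LaurentSeries.derivative K f).coeff n = n * f.coeff n := by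
  rw [HahnSeries.coeff_single_mul, one_mul, LaurentSeries.derivative_apply,
    LaurentSeries.hasseDeriv_coeff]
  simp

theorem coeff_C_mul_apply (c : K) (f : LaurentSeries K) (n : ℤ) :
    (HahnSeries.C c * f).coeff n = c * f.coeff n := by
  rw [HahnSeries.C_mul_eq_smul, HahnSeries.coeff_smul, smul_eq_mul]

variable (K) in
/-- The Euler operator `z d/dz` on `K((z))`. -/
def eulerOp : LaurentSeries K →+ LaurentSeries K :=
  AddMonoidHom.mk' (fun f => HahnSeries.single 1 1 * LaurentSeries.derivative K f)
    fun f g => by rw [map_add, mul_add]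

theorem eulerOp_apply (f : LaurentSeries K) :
    eulerOp K f = HahnSeries.single 1 1 * LaurentSeries.derivative K f := rfl

theorem coeff_eulerOp (f : LaurentSeries K) (n : ℤ) : (eulerOp K f).coeff n = n * f.coeff n :=
  coeff_single_mul_derivative f n

theorem eulerOp_mul (f g : LaurentSeries K) :
    eulerOp K (f * g) = f * eulerOp K g + eulerOp K f * g := by
  have hs (h : LaurentSeries K) : (eulerOp K h).support ⊆ h.support := by
    intro i hi h0
    apply hi
    simp only [coeff_eulerOp]
    rw [h0, mul_zero]
  ext n
  -- The Euler operator may shrink supports; all three sums are taken over the antidiagonal of the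
  -- supports of `f` and `g`, where the claim is `n = p.1 + p.2`.
  rw [HahnSeries.coeff_add, coeff_eulerOp, HahnSeries.coeff_mul,
    HahnSeries.coeff_mul_right' g.isPWO_support (hs g),
    HahnSeries.coeff_mul_left' f.isPWO_support (hs f), Finset.mul_sum, ← Finset.sum_add_distrib]
  refine Finset.sum_congr rfl fun p hp => ?_
  rw [Finset.mem_antidiagonal] at hp
  rw [coeff_eulerOp, coeff_eulerOp, ← hp.2.2]
  push_cast
  ring

theorem eulerOp_C_mul (c : K) (f : LaurentSeries K) :
    eulerOp K (HahnSeries.C c * f) = HahnSeries.C c * eulerOp K f := by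
  ext n
  rw [coeff_eulerOp, coeff_C_mul_apply, coeff_C_mul_apply, coeff_eulerOp]
  ring

theorem eulerOp_ofPowerSeries (f : PowerSeries K) :
    eulerOp K (HahnSeries.ofPowerSeries ℤ K f) =
      HahnSeries.ofPowerSeries ℤ K (X * PowerSeries.derivative K f) := by
  ext n
  rw [coeff_eulerOp]
  rcases lt_or_ge n 0 with hn | hn
  · rw [coeff_ofPowerSeries_of_neg _ _ hn, coeff_ofPowerSeries_of_neg _ _ hn, mul_zero]
  · lift n to ℕ using hn
    rw [coeff_ofPowerSeries_natCast, coeff_ofPowerSeries_natCast]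
    cases n with
    | zero => simp
    | succ n => rw [coeff_succ_X_mul, coeff_derivative]; push_cast; ring

end Laurent

/-! ### Powers of `X`, the operator `D`, and Lagrange inversion. -/

section Lagrange

variable {K : Type*} [Field K] (ψ y : PowerSeries K)

variable {ψ y} in
theorem constantCoeff_subst_psi (hψ : constantCoeff ψ = 0) (hy : constantCoeff y = 0) :
    constantCoeff (subst y ψ : PowerSeries K) = 0 :=
  constantCoeff_subst_eq_zero hy _ hψ

variable [CharZero K]

/-- `e^{c ψ(y(z))}`. -/
def expPsi (c : K) : PowerSeries K := subst (C c * subst y ψ) (exp K)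

variable {ψ y}

theorem expPsi_add (hψ : constantCoeff ψ = 0) (hy : constantCoeff y = 0) (c d : K) :
    expPsi ψ y (c + d) = expPsi ψ y c * expPsi ψ y d := by
  have := constantCoeff_subst_psi hψ hy
  rw [expPsi, map_add, add_mul, exp_subst_add (by simp [this]) (by simp [this]), expPsi, expPsi]

theorem expPsi_zero : expPsi ψ y 0 = 1 := by
  rw [expPsi, map_zero, zero_mul, exp_subst_zero]

theorem subst_exp_psi (hψ : constantCoeff ψ = 0) (hy : constantCoeff y = 0) (c : K) :
    subst y (subst (C c * ψ) (exp K)) = expPsi ψ y c := by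
  have h := HasSubst.of_constantCoeff_zero' hy
  rw [subst_comp_subst_apply (HasSubst.of_constantCoeff_zero' (by simp [hψ])) h, subst_mul h,
    subst_C]
  rfl

theorem constantCoeff_expPsi (hψ : constantCoeff ψ = 0) (hy : constantCoeff y = 0) (c : K) :
    constantCoeff (expPsi ψ y c) = 1 := by
  have h0 := constantCoeff_subst_psi hψ hy
  have h : constantCoeff (C c * subst y ψ : PowerSeries K) = 0 := by simp [h0]
  -- The constant term `1` of the exponential is split off, since a substitution into a series
  -- without constant term again has none.
  have e : subst (C c * subst y ψ : PowerSeries K) (exp K) =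
      1 + subst (C c * subst y ψ : PowerSeries K) (exp K - 1) := by
    have h' := HasSubst.of_constantCoeff_zero' h
    rw [subst_sub h', ← coe_substAlgHom h', map_one]
    ring
  rw [expPsi, e, map_add, show constantCoeff (subst (C c * subst y ψ : PowerSeries K) (exp K - 1)) = 0 from
    constantCoeff_subst_eq_zero h _ (by simp)]
  simp

theorem seriesX_eq : seriesX ψ y =
    HahnSeries.single 1 1 * HahnSeries.ofPowerSeries ℤ K (expPsi ψ y (-1)) := by
  rw [seriesX, map_mul, HahnSeries.ofPowerSeries_X, expPsi, map_neg C, map_one C, neg_one_mul]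

theorem ofPowerSeries_expPsi_zpow (hψ : constantCoeff ψ = 0) (hy : constantCoeff y = 0) (m : ℤ) :
    HahnSeries.ofPowerSeries ℤ K (expPsi ψ y (-1)) ^ m =
      HahnSeries.ofPowerSeries ℤ K (expPsi ψ y (-m)) := by
  have hn (n : ℕ) : HahnSeries.ofPowerSeries ℤ K (expPsi ψ y (-1)) ^ n =
      HahnSeries.ofPowerSeries ℤ K (expPsi ψ y (-n)) := by
    induction n with
    | zero => simp [expPsi_zero]
    | succ n ih =>
      rw [pow_succ, ih, ← map_mul, ← expPsi_add hψ hy]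
      congr 2
      push_cast
      ring
  obtain ⟨n, rfl | rfl⟩ := m.eq_nat_or_neg
  · rw [zpow_natCast, hn, Int.cast_natCast]
  · rw [zpow_neg, zpow_natCast, hn, inv_eq_iff_eq_inv]
    refine eq_inv_of_mul_eq_one_left ?_
    rw [← map_mul, ← expPsi_add hψ hy]
    simp [expPsi_zero]

theorem seriesX_zpow (hψ : constantCoeff ψ = 0) (hy : constantCoeff y = 0) (m : ℤ) :
    seriesX ψ y ^ m =
      HahnSeries.single m 1 * HahnSeries.ofPowerSeries ℤ K (expPsi ψ y (-m)) := by
  rw [seriesX_eq, mul_zpow, ofPowerSeries_expPsi_zpow hψ hy]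
  congr 1
  exact (RatFunc.single_zpow (F := K) m).symm

theorem coeff_seriesX_zpow (hψ : constantCoeff ψ = 0) (hy : constantCoeff y = 0) (m : ℤ) :
    ∀ i < m, (seriesX ψ y ^ m).coeff i = 0 := by
  intro i hi
  rw [seriesX_zpow hψ hy, HahnSeries.coeff_single_mul, coeff_ofPowerSeries_of_neg _ _ (by omega),
    mul_zero]

theorem coeff_seriesX_zpow_self (hψ : constantCoeff ψ = 0) (hy : constantCoeff y = 0) (m : ℤ) :
    (seriesX ψ y ^ m).coeff m = 1 := by
  rw [seriesX_zpow hψ hy, HahnSeries.coeff_single_mul, sub_self, one_mul]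
  have := coeff_ofPowerSeries_natCast (expPsi ψ y (-m)) 0
  simpa [constantCoeff_expPsi hψ hy] using this

theorem seriesX_ne_zero (hψ : constantCoeff ψ = 0) (hy : constantCoeff y = 0) :
    seriesX ψ y ≠ 0 := fun h => by
  have := coeff_seriesX_zpow_self hψ hy 1
  rw [zpow_one, h] at this
  simp at this

theorem eulerOp_seriesX (hψ : constantCoeff ψ = 0) (hy : constantCoeff y = 0) :
    eulerOp K (seriesX ψ y) = seriesX ψ y * seriesQ ψ y := by
  have := seriesX_ne_zero hψ hy
  rw [seriesQ, eulerOp_apply]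
  field_simp

theorem eulerOp_seriesX_zpow (hψ : constantCoeff ψ = 0) (hy : constantCoeff y = 0) (m : ℤ) :
    eulerOp K (seriesX ψ y ^ m) = HahnSeries.C (m : K) * (seriesX ψ y ^ m * seriesQ ψ y) := by
  have hX := seriesX_ne_zero hψ hy
  have hs (m : ℤ) : eulerOp K (seriesX ψ y ^ (m + 1)) =
      seriesX ψ y ^ m * (seriesX ψ y * seriesQ ψ y) + eulerOp K (seriesX ψ y ^ m) * seriesX ψ y := by
    rw [zpow_add_one₀ hX, eulerOp_mul, eulerOp_seriesX hψ hy]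
  induction m using Int.induction_on with
  | zero =>
    ext n
    rw [coeff_eulerOp, zpow_zero, HahnSeries.coeff_one]
    split_ifs with h <;> simp [h]
  | succ m ih =>
    rw [hs, ih, zpow_add_one₀ hX]
    push_cast
    rw [map_add, map_one]
    ring
  -- The recursion `hs` is run backwards, from `X^{-m}` to `X^{-m-1}`, by cancelling a factor `X`.
  | pred m ih =>
    have h := hs (-m - 1)
    rw [sub_add_cancel, ih] at h
    apply mul_right_cancel₀ hX
    rw [eq_sub_of_add_eq' h.symm, zpow_sub_one₀ hX]
    push_cast
    rw [map_sub, map_one]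
    field_simp

/-- Consequently `Q⁻¹` is a power series too, and `D` does not lower the order in `z`. -/
theorem exists_seriesQ_eq (hψ : constantCoeff ψ = 0) (hy : constantCoeff y = 0) :
    ∃ q : PowerSeries K, constantCoeff q = 1 ∧ seriesQ ψ y = HahnSeries.ofPowerSeries ℤ K q := by
  -- From `X = z e^{-ψ(y(z))}`: `z/X = e^{ψ(y(z))}`, so `Q = e^{ψ(y(z))} d/dz (z e^{-ψ(y(z))})`.
  refine ⟨expPsi ψ y 1 * PowerSeries.derivative K (X * expPsi ψ y (-1)), ?_, ?_⟩
  · simp [constantCoeff_expPsi hψ hy]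
  · have e1 : seriesX ψ y = HahnSeries.ofPowerSeries ℤ K (X * expPsi ψ y (-1)) := by
      rw [seriesX_eq, map_mul, HahnSeries.ofPowerSeries_X]
    have e2 : expPsi ψ y (-1) * expPsi ψ y 1 = 1 := by
      rw [← expPsi_add hψ hy, neg_add_cancel, expPsi_zero]
    apply mul_left_cancel₀ (seriesX_ne_zero hψ hy)
    rw [← eulerOp_seriesX hψ hy, e1, eulerOp_ofPowerSeries, ← map_mul]
    congr 1
    linear_combination (- X * PowerSeries.derivative K (X * expPsi ψ y (-1))) * e2

theorem coeff_seriesQ (hψ : constantCoeff ψ = 0) (hy : constantCoeff y = 0) :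
    ∀ i < 0, (seriesQ ψ y).coeff i = 0 := by
  obtain ⟨q, -, hq⟩ := exists_seriesQ_eq hψ hy
  rw [hq]
  exact coeff_ofPowerSeries_of_neg q

theorem coeff_zero_seriesQ (hψ : constantCoeff ψ = 0) (hy : constantCoeff y = 0) :
    (seriesQ ψ y).coeff 0 = 1 := by
  obtain ⟨q, h1, hq⟩ := exists_seriesQ_eq hψ hy
  have := coeff_ofPowerSeries_natCast q 0
  rw [hq]
  simpa [h1] using this

theorem seriesQ_ne_zero (hψ : constantCoeff ψ = 0) (hy : constantCoeff y = 0) :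
    seriesQ ψ y ≠ 0 := fun h => by
  simpa [h] using coeff_zero_seriesQ hψ hy

theorem coeff_seriesQ_inv (hψ : constantCoeff ψ = 0) (hy : constantCoeff y = 0) :
    ∀ i < 0, (seriesQ ψ y)⁻¹.coeff i = 0 := by
  obtain ⟨q, h1, hq⟩ := exists_seriesQ_eq hψ hy
  have h : seriesQ ψ y * HahnSeries.ofPowerSeries ℤ K q⁻¹ = 1 := by
    rw [hq, ← map_mul, PowerSeries.mul_inv_cancel _ (by simp [h1]), map_one]
  rw [← eq_inv_of_mul_eq_one_right h]
  exact coeff_ofPowerSeries_of_neg _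

variable (ψ y) in
/-- The operator `D = Q⁻¹ z d/dz` on `K((z))`. -/
def laurentD : AddMonoid.End (LaurentSeries K) :=
  AddMonoidHom.mk' (fun f => (seriesQ ψ y)⁻¹ * eulerOp K f) fun f g => by rw [map_add, mul_add]

theorem laurentD_pow_succ_apply (f : LaurentSeries K) (j : ℕ) :
    (laurentD ψ y ^ (j + 1)) f = (seriesQ ψ y)⁻¹ * eulerOp K ((laurentD ψ y ^ j) f) := by
  rw [pow_succ']
  rfl

theorem laurentD_pow_C_mul (c : K) (f : LaurentSeries K) (j : ℕ) :
    (laurentD ψ y ^ j) (HahnSeries.C c * f) = HahnSeries.C c * (laurentD ψ y ^ j) f := by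
  induction j with
  | zero => rfl
  | succ j ih =>
    rw [laurentD_pow_succ_apply, laurentD_pow_succ_apply, ih, eulerOp_C_mul, mul_left_comm]

theorem laurentD_pow_seriesX_zpow (hψ : constantCoeff ψ = 0) (hy : constantCoeff y = 0) (m : ℤ)
    (j : ℕ) :
    (laurentD ψ y ^ j) (seriesX ψ y ^ m) = HahnSeries.C ((m : K) ^ j) * seriesX ψ y ^ m := by
  induction j with
  | zero => simp
  | succ j ih =>
    rw [laurentD_pow_succ_apply, ih, eulerOp_C_mul,
      eulerOp_seriesX_zpow hψ hy, mul_comm (seriesX ψ y ^ m), pow_succ, map_mul]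
    have := seriesQ_ne_zero hψ hy
    field_simp

theorem coeff_laurentD_pow (hψ : constantCoeff ψ = 0) (hy : constantCoeff y = 0) {f : LaurentSeries K}
    {N : ℤ} (hf : ∀ i < N, f.coeff i = 0) (j : ℕ) :
    ∀ i < N, ((laurentD ψ y ^ j) f).coeff i = 0 := by
  induction j with
  | zero => simpa using hf
  | succ j ih =>
    rw [laurentD_pow_succ_apply, ← zero_add N]
    refine coeff_mul_eq_zero_of_lt (coeff_seriesQ_inv hψ hy) fun i hi => ?_
    rw [coeff_eulerOp, ih i hi, mul_zero]

/-- The residue pairing of `X^a` and `X^{-m} Q dz / z`. -/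
theorem coeff_zero_seriesX_zpow_mul (hψ : constantCoeff ψ = 0) (hy : constantCoeff y = 0) (m a : ℤ) :
    (seriesX ψ y ^ (-m) * seriesQ ψ y * seriesX ψ y ^ a).coeff 0 = if m = a then 1 else 0 := by
  rw [mul_right_comm, ← zpow_add₀ (seriesX_ne_zero hψ hy)]
  split_ifs with h
  · subst h
    rw [neg_add_cancel, zpow_zero, one_mul]
    exact coeff_zero_seriesQ hψ hy
  -- For `m ≠ a`, `(a - m) X^{a-m} Q` is the Euler derivative of `X^{a-m}`, hence has no `z⁰` term;
  -- characteristic zero allows division by `a - m`.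
  · have h1 := congrArg (fun f => f.coeff 0) (eulerOp_seriesX_zpow hψ hy (-m + a))
    simp only [coeff_eulerOp, Int.cast_zero, zero_mul, coeff_C_mul_apply] at h1
    refine (mul_eq_zero.1 h1.symm).resolve_left ?_
    exact_mod_cast fun h' => h (by omega)

/-- Lagrange inversion: `∑ₘ mʲ Xᵐ [z⁰] (X^{-m} Q F) = Dʲ F`. -/
theorem hasFinSum_lagrange (hψ : constantCoeff ψ = 0) (hy : constantCoeff y = 0) (j : ℕ) (n : ℤ)
    (F : LaurentSeries K) :
    HasFinSum (fun m : ℤ => (m : K) ^ j * (seriesX ψ y ^ m).coeff n *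
      (seriesX ψ y ^ (-m) * seriesQ ψ y * F).coeff 0) (((laurentD ψ y ^ j) F).coeff n) := by
  -- Induction on the number `d` of exponents up to `n` at which `F` may be non-zero. For `d = 0`
  -- every term vanishes: `Xᵐ` starts at `zᵐ`, and `X^{-m} Q F` beyond `z^{n-m}`.
  have key (d : ℕ) : ∀ F : LaurentSeries K, (∀ i < n + 1 - d, F.coeff i = 0) →
      HasFinSum (fun m : ℤ => (m : K) ^ j * (seriesX ψ y ^ m).coeff n *
        (seriesX ψ y ^ (-m) * seriesQ ψ y * F).coeff 0) (((laurentD ψ y ^ j) F).coeff n) := by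
    induction d with
    | zero =>
      intro F hF
      rw [coeff_laurentD_pow hψ hy hF j n (by simp)]
      convert hasFinSum_zero using 2 with m
      by_cases hm : n < m
      · rw [coeff_seriesX_zpow hψ hy m n hm, mul_zero, zero_mul]
      · rw [coeff_mul_eq_zero_of_lt (coeff_mul_eq_zero_of_lt (coeff_seriesX_zpow hψ hy (-m))
          (coeff_seriesQ hψ hy)) hF 0 (by push_cast; omega), mul_zero]
    | succ d ih =>
      intro F hF
      -- The lowest possible exponent of `F`. As `X^a = z^a + ⋯`, subtracting `c X^a` removes this
      -- term, and for `X^a` itself duality leaves only `m = a`.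
      set a : ℤ := n + 1 - (d + 1 : ℕ) with ha
      set c := F.coeff a
      have h1 := ih (F - HahnSeries.C c * seriesX ψ y ^ a) fun i hi => by
        rw [HahnSeries.coeff_sub, coeff_C_mul_apply]
        rcases lt_or_eq_of_le (show i ≤ a by push_cast at ha; omega) with h | h
        · rw [hF i h, coeff_seriesX_zpow hψ hy a i h, mul_zero, sub_zero]
        · rw [h, coeff_seriesX_zpow_self hψ hy, mul_one, sub_self]
      have h2 : HasFinSum (fun m : ℤ => (m : K) ^ j * (seriesX ψ y ^ m).coeff n *
          (seriesX ψ y ^ (-m) * seriesQ ψ y * (HahnSeries.C c * seriesX ψ y ^ a)).coeff 0)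
          (((laurentD ψ y ^ j) (HahnSeries.C c * seriesX ψ y ^ a)).coeff n) := by
        convert hasFinSum_of_finset {a} ?_ using 1
        · rw [Finset.sum_singleton, laurentD_pow_C_mul, laurentD_pow_seriesX_zpow hψ hy,
            mul_left_comm _ (HahnSeries.C c), coeff_C_mul_apply, coeff_C_mul_apply,
            coeff_C_mul_apply,
            coeff_zero_seriesX_zpow_mul hψ hy, if_pos rfl]
          ring
        · intro m hm
          rw [mul_left_comm, coeff_C_mul_apply, coeff_zero_seriesX_zpow_mul hψ hy,
            if_neg (by simpa using hm), mul_zero, mul_zero]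
      convert h1.add h2 using 1
      · funext m
        rw [← mul_add, ← HahnSeries.coeff_add, ← mul_add, sub_add_cancel]
      · rw [← HahnSeries.coeff_add, ← map_add, sub_add_cancel]
  refine key (n + 1 - F.order).toNat F fun i hi => HahnSeries.coeff_eq_zero_of_lt_order ?_
  have := Int.self_le_toNat (n + 1 - F.order)
  omega

end Lagrange

/-! ### Polynomial dependence of `L_r` on `v`, uniformly in the power of `y`. -/

section BoundedDegree

variable (K : Type*) [Field K]

/-- The series in `K[v]⟦y⟧` whose coefficients have bounded degree in `v`. -/
def boundedDegree : Subring (PowerSeries (Polynomial K)) where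
  carrier := {g | ∃ J, ∀ n, (coeff n g).natDegree ≤ J}
  mul_mem' := by
    rintro f g ⟨a, ha⟩ ⟨b, hb⟩
    refine ⟨a + b, fun n => ?_⟩
    rw [coeff_mul]
    refine Polynomial.natDegree_sum_le_of_forall_le _ _ fun p _ => ?_
    exact Polynomial.natDegree_mul_le.trans (Nat.add_le_add (ha _) (hb _))
  one_mem' := ⟨0, fun n => by rw [coeff_one]; split_ifs <;> simp⟩
  add_mem' := by
    rintro f g ⟨a, ha⟩ ⟨b, hb⟩
    refine ⟨max a b, fun n => ?_⟩
    rw [map_add]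
    exact (Polynomial.natDegree_add_le _ _).trans (max_le_max (ha n) (hb n))
  zero_mem' := ⟨0, by simp⟩
  neg_mem' := by
    rintro f ⟨a, ha⟩
    exact ⟨a, fun n => by rw [map_neg, Polynomial.natDegree_neg]; exact ha n⟩

variable {K}

theorem C_mem_boundedDegree (p : Polynomial K) : C p ∈ boundedDegree K :=
  ⟨p.natDegree, fun n => by rw [coeff_C]; split_ifs <;> simp⟩

theorem map_C_mem_boundedDegree (f : PowerSeries K) :
    PowerSeries.map Polynomial.C f ∈ boundedDegree K :=
  ⟨0, fun n => by simp⟩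

theorem derivative_mem_boundedDegree {g : PowerSeries (Polynomial K)} (hg : g ∈ boundedDegree K) :
    PowerSeries.derivative (Polynomial K) g ∈ boundedDegree K := by
  obtain ⟨a, ha⟩ := hg
  refine ⟨a, fun n => ?_⟩
  rw [coeff_derivative]
  refine Polynomial.natDegree_mul_le.trans ?_
  have : ((n : Polynomial K) + 1).natDegree = 0 := by
    exact_mod_cast Polynomial.natDegree_natCast (R := K) (n + 1)
  rw [this]
  exact ha _

theorem coeff_mul_mem {S : Type*} [CommRing S] (B : Subring S) {f g : PowerSeries S}
    (hf : ∀ k, coeff k f ∈ B) (hg : ∀ k, coeff k g ∈ B) (k : ℕ) : coeff k (f * g) ∈ B := by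
  rw [coeff_mul]
  exact B.sum_mem fun p _ => B.mul_mem (hf _) (hg _)

theorem coeff_pow_mem {S : Type*} [CommRing S] (B : Subring S) {f : PowerSeries S}
    (hf : ∀ k, coeff k f ∈ B) (i k : ℕ) : coeff k (f ^ i) ∈ B := by
  induction i generalizing k with
  | zero =>
    rw [pow_zero, coeff_one]
    split_ifs
    exacts [B.one_mem, B.zero_mem]
  | succ i ih => rw [pow_succ]; exact coeff_mul_mem B ih hf k

theorem coeff_varV_mem (k : ℕ) : coeff k (varV K) ∈ boundedDegree K := by
  rw [varV, coeff_C]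
  split_ifs
  exacts [C_mem_boundedDegree _, (boundedDegree K).zero_mem]

variable [CharZero K]

theorem rat_smul_mem_boundedDegree (q : ℚ) {g : PowerSeries (Polynomial K)}
    (hg : g ∈ boundedDegree K) : q • g ∈ boundedDegree K := by
  obtain ⟨a, ha⟩ := hg
  refine ⟨a, fun n => ?_⟩
  rw [map_rat_smul]
  exact (Polynomial.natDegree_smul_le q _).trans (ha n)

theorem coeff_seriesL0_mem (ψ : PowerSeries K) (k : ℕ) :
    coeff k (seriesL0 ψ) ∈ boundedDegree K := by
  rw [seriesL0, coeff_formalExp_of_constantCoeff_eq_zero constantCoeff_seriesL0_exponent]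
  refine (boundedDegree K).sum_mem fun i _ => rat_smul_mem_boundedDegree _ ?_
  refine coeff_pow_mem _ (coeff_mul_mem _ coeff_varV_mem fun k => ?_) i k
  rw [applyOp, coeff_mk]
  exact (boundedDegree K).mul_mem (C_mem_boundedDegree _) (map_C_mem_boundedDegree _)

/-- Provides one bound on `j` for all powers of `y`. It makes the sum over `j` finite, so that it
can be exchanged with the sum over `m`. -/
theorem coeff_seriesL_mem (ψ : PowerSeries K) (r k : ℕ) :
    coeff k (seriesL ψ r) ∈ boundedDegree K := by
  induction r generalizing k with
  | zero => exact coeff_seriesL0_mem ψ k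
  | succ r ih =>
    rw [seriesL_succ, map_add, coeff_dy]
    refine (boundedDegree K).add_mem (derivative_mem_boundedDegree (ih k)) ?_
    refine coeff_mul_mem _ (coeff_mul_mem _ coeff_varV_mem fun k => ?_) ih k
    rw [coeff_C]
    split_ifs
    exacts [map_C_mem_boundedDegree _, (boundedDegree K).zero_mem]

end BoundedDegree

/-! ### Summation over `r` as a Taylor expansion at `y = 0`. -/

section Taylor

variable {K : Type*} [Field K] [CharZero K] {ψ y : PowerSeries K}

theorem coeff_pow_eq_zero_of_lt {R : Type*} [CommRing R] {f : PowerSeries R}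
    (hf : constantCoeff f = 0) {i n : ℕ} (h : n < i) : coeff n (f ^ i) = 0 :=
  X_pow_dvd_iff.1 (pow_dvd_pow_of_dvd (X_dvd_iff.2 hf) i) n h

theorem coeff_subst_eq_sum {R : Type*} [CommRing R] {f : PowerSeries R}
    (hf : constantCoeff f = 0) (g : PowerSeries R) (n : ℕ) :
    coeff n (subst f g) = ∑ i ∈ Finset.range (n + 1), coeff i g * coeff n (f ^ i) := by
  rw [coeff_subst' (HasSubst.of_constantCoeff_zero' hf)]
  refine finsum_eq_sum_of_support_subset _ fun i hi => ?_
  by_contra h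
  apply hi
  simp only [Finset.coe_range, Set.mem_Iio, not_lt] at h
  simp only [coeff_pow_eq_zero_of_lt hf (show n < i by omega), smul_zero]

theorem coeff_coeff_expUY (hy : constantCoeff y = 0) (n i : ℕ) :
    ((expUY y).coeff (n : ℤ)).coeff i = (i.factorial : K)⁻¹ * coeff n (y ^ i) := by
  have h0 : constantCoeff (C Polynomial.X * PowerSeries.map Polynomial.C y) = 0 := by
    rw [map_mul, ← coeff_zero_eq_constantCoeff_apply (PowerSeries.map _ _), coeff_map]
    simp [hy]
  rw [expUY, coeff_ofPowerSeries_natCast, coeff_subst_eq_sum h0, Polynomial.finsetSum_coeff]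
  have ht (j : ℕ) : (coeff j (exp (Polynomial K)) *
      coeff n ((C Polynomial.X * PowerSeries.map Polynomial.C y) ^ j)).coeff i =
      if i = j then (i.factorial : K)⁻¹ * coeff n (y ^ i) else 0 := by
    have h1 : coeff j (exp (Polynomial K)) = Polynomial.C ((j.factorial : K)⁻¹) := by
      rw [coeff_exp, IsScalarTower.algebraMap_apply ℚ K (Polynomial K)]
      simp
    rw [mul_pow, ← map_pow, ← map_pow, coeff_C_mul, coeff_map, h1, Polynomial.coeff_C_mul,
      Polynomial.coeff_mul_C, Polynomial.coeff_X_pow]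
    split_ifs with h
    · rw [h, one_mul]
    · rw [zero_mul, mul_zero]
  rw [Finset.sum_congr rfl fun j _ => ht j, Finset.sum_ite_eq]
  split_ifs with h
  · rfl
  · rw [coeff_pow_eq_zero_of_lt hy (by simpa using h), mul_zero]

/-- Taylor expansion of `f^{(s)}(y(z))` in terms of the derivatives of `f` at `0`. -/
theorem hasFinSum_taylor (hy : constantCoeff y = 0) (f : PowerSeries K) (s : ℕ) (c : K) (a m : ℤ) :
    (∀ r ∉ Finset.range (s + ((m - a).toNat + 1)),
      ((expUY y * HahnSeries.single a (Polynomial.monomial s c)).coeff m).coeff r = 0) ∧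
    HasFinSum (fun r : ℕ => constantCoeff ((PowerSeries.derivative K)^[r] f) *
      ((expUY y * HahnSeries.single a (Polynomial.monomial s c)).coeff m).coeff r)
      (c * (HahnSeries.ofPowerSeries ℤ K
        (subst y ((PowerSeries.derivative K)^[s] f))).coeff (m - a)) := by
  rw [HahnSeries.coeff_mul_single]
  rcases lt_or_ge (m - a) 0 with h | h
  · have h1 : (expUY y).coeff (m - a) = 0 := coeff_ofPowerSeries_of_neg _ _ h
    rw [h1, coeff_ofPowerSeries_of_neg _ _ h]
    simpa using hasFinSum_zero
  · lift m - a to ℕ using h with n hn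
    rw [Int.toNat_natCast]
    have h1 (r : ℕ) : ((expUY y).coeff (n : ℤ) * Polynomial.monomial s c).coeff r =
        if s ≤ r then ((r - s).factorial : K)⁻¹ * coeff n (y ^ (r - s)) * c else 0 := by
      rw [← Polynomial.C_mul_X_pow_eq_monomial, ← mul_assoc, Polynomial.coeff_mul_X_pow',
        Polynomial.coeff_mul_C, coeff_coeff_expUY hy]
    have h2 : ∀ r ∉ Finset.range (s + (n + 1)),
        ((expUY y).coeff (n : ℤ) * Polynomial.monomial s c).coeff r = 0 := fun r hr => by
      rw [Finset.mem_range, not_lt] at hr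
      rw [h1, if_pos (by omega), coeff_pow_eq_zero_of_lt hy (by omega), mul_zero, zero_mul]
    refine ⟨h2, ?_⟩
    convert hasFinSum_of_finset (Finset.range (s + (n + 1))) fun r hr => ?_ using 1
    -- The factor `u^s` kills all `r < s`. For `r = s + i` the constant term of `f^{(s+i)}` is `i!`
    -- times the `i`-th coefficient of `f^{(s)}`, which cancels the `1/i!` from `e^{uy}`.
    · rw [Finset.sum_range_add, Finset.sum_eq_zero fun r hr => ?_, zero_add,
        coeff_ofPowerSeries_natCast, coeff_subst_eq_sum hy, Finset.mul_sum]
      · refine Finset.sum_congr rfl fun i _ => ?_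
        have hi : (i.factorial : K) ≠ 0 := by exact_mod_cast i.factorial_ne_zero
        rw [h1, if_pos (by omega), Nat.add_sub_cancel_left, Nat.add_comm s i,
          Function.iterate_add_apply, constantCoeff_iterate_derivative]
        field_simp
      · rw [h1, if_neg (by simpa using hr), mul_zero]
    · rw [h2 r hr, mul_zero]

end Taylor

/-! ### The identity for monomials and its extension to general `H`. -/

section Main

variable {K : Type*} [Field K]

theorem map_lcoeff_add (G G' : LaurentSeries (Polynomial K)) (r : ℕ) :
    HahnSeries.map (G + G') (Polynomial.lcoeff K r) =
      HahnSeries.map G (Polynomial.lcoeff K r) + HahnSeries.map G' (Polynomial.lcoeff K r) := by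
  ext n
  simp

theorem map_evalRingHom_eq_sum {g : PowerSeries (Polynomial K)} {J : ℕ}
    (hg : ∀ n, (coeff n g).natDegree ≤ J) (m : K) :
    PowerSeries.map (Polynomial.evalRingHom m) g =
      ∑ j ∈ Finset.range (J + 1), C (m ^ j) * PowerSeries.mk fun n => (coeff n g).coeff j := by
  ext n
  rw [coeff_map, Polynomial.coe_evalRingHom,
    Polynomial.eval_eq_sum_range' (Nat.lt_succ_of_le (hg n)), map_sum]
  refine Finset.sum_congr rfl fun j _ => ?_
  rw [coeff_C_mul, coeff_mk, mul_comm]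

variable [CharZero K] (ψ y : PowerSeries K)

/-- The coefficient of `v^j` in the coefficient of `ħ^i` in `L_r`, as a series in `y`. -/
def coeffVL (r i j : ℕ) : PowerSeries K :=
  PowerSeries.mk fun n => (coeff n (coeff i (seriesL ψ r))).coeff j

/-- The contribution of `[ħ^i] φ_m` and of `G = [ħ^j] H` to the coefficient of `z^n` in the
left-hand side. -/
def lhsCoeff (i : ℕ) (n : ℤ) (G : LaurentSeries (Polynomial K)) (p : ℤ × ℕ) : K :=
  coeff i (phiDerivZero ψ p.1 p.2) * ((expUY y * G).coeff p.1).coeff p.2 *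
    (seriesX ψ y ^ p.1).coeff n

/-- The contribution of `[ħ^i] L_r` and of `G = [ħ^j] H` to the coefficient of `z^n` in the
right-hand side. -/
def rhsCoeff (i : ℕ) (n : ℤ) (G : LaurentSeries (Polynomial K)) (p : ℕ × ℕ) : K :=
  ((laurentD ψ y ^ p.1) (HahnSeries.ofPowerSeries ℤ K (subst y (coeffVL ψ p.2 i p.1)) *
    (seriesQ ψ y)⁻¹ * HahnSeries.map G (Polynomial.lcoeff K p.2))).coeff n

/-- The identity for fixed powers of `ħ` and `z`. -/
def SumsAgree (i : ℕ) (n : ℤ) (G : LaurentSeries (Polynomial K)) : Prop :=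
  ∃ s, HasFinSum (lhsCoeff ψ y i n G) s ∧ HasFinSum (rhsCoeff ψ y i n G) s

variable {ψ y}

theorem SumsAgree.add {i : ℕ} {n : ℤ} {G G' : LaurentSeries (Polynomial K)}
    (h : SumsAgree ψ y i n G) (h' : SumsAgree ψ y i n G') : SumsAgree ψ y i n (G + G') := by
  obtain ⟨s, hs, ht⟩ := h
  obtain ⟨s', hs', ht'⟩ := h'
  refine ⟨s + s', ?_, ?_⟩
  · convert hs.add hs' using 2 with p
    simp only [lhsCoeff, mul_add, HahnSeries.coeff_add, Polynomial.coeff_add]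
    ring
  · convert ht.add ht' using 2 with p
    simp only [rhsCoeff, map_lcoeff_add, mul_add, map_add, HahnSeries.coeff_add]

/-- The factor `e^{mψ(y(z))}` of `∂^s φ_m` equals `z^m X^{-m}`, which moves the extraction from
`z^{m-a}` to `z⁰`. Expanding `L_s` at `v = m` in powers of `m` gives the sum over `j`. -/
theorem coeff_subst_iterate_derivative_phi (hψ : constantCoeff ψ = 0) (hy : constantCoeff y = 0)
    {s i J : ℕ} (hJ : ∀ n, (coeff n (coeff i (seriesL ψ s))).natDegree ≤ J) (a m : ℤ) :
    (HahnSeries.ofPowerSeries ℤ K (subst y ((PowerSeries.derivative K)^[s]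
      (coeff i (phi ψ m))))).coeff (m - a) =
    ∑ j ∈ Finset.range (J + 1), (m : K) ^ j * (seriesX ψ y ^ (-m) *
      (HahnSeries.ofPowerSeries ℤ K (subst y (coeffVL ψ s i j)) * HahnSeries.single a 1)).coeff
        0 := by
  have h := HasSubst.of_constantCoeff_zero' hy
  rw [← coeff_iterate_dy, iterate_dy_phi hψ, coeff_C_mul, evalV, coeff_map,
    map_evalRingHom_eq_sum hJ, subst_mul h, subst_exp_psi hψ hy, ← coe_substAlgHom h, map_sum,
    Finset.mul_sum, map_sum, HahnSeries.coeff_sum]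
  refine Finset.sum_congr rfl fun j _ => ?_
  rw [coe_substAlgHom h, subst_mul h, subst_C]
  have e : HahnSeries.ofPowerSeries ℤ K (expPsi ψ y m * (C ((m : K) ^ j) *
      subst y (coeffVL ψ s i j))) = HahnSeries.C ((m : K) ^ j) *
      (HahnSeries.ofPowerSeries ℤ K (expPsi ψ y m) *
        HahnSeries.ofPowerSeries ℤ K (subst y (coeffVL ψ s i j))) := by
    rw [map_mul, map_mul, HahnSeries.ofPowerSeries_C]
    ring
  refine (congrArg (fun f => HahnSeries.coeff f (m - a)) e).trans ?_
  rw [coeff_C_mul_apply, seriesX_zpow hψ hy, mul_assoc, HahnSeries.coeff_single_mul, one_mul,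
    ← mul_assoc, HahnSeries.coeff_mul_single, mul_one, Int.cast_neg, neg_neg, zero_sub, neg_neg]

theorem sumsAgree_single (hψ : constantCoeff ψ = 0) (hy : constantCoeff y = 0) (i : ℕ) (n a : ℤ)
    (s : ℕ) (c : K) : SumsAgree ψ y i n (HahnSeries.single a (Polynomial.monomial s c)) := by
  obtain ⟨J, hJ⟩ := coeff_seriesL_mem ψ s i
  have hQ := seriesQ_ne_zero hψ hy
  -- The `Q⁻¹` here cancels the `Q` of the residue pairing in `hasFinSum_lagrange`.
  set F : ℕ → LaurentSeries K := fun j =>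
    HahnSeries.ofPowerSeries ℤ K (subst y (coeffVL ψ s i j)) * (seriesQ ψ y)⁻¹ *
      HahnSeries.single a c with hF
  refine ⟨∑ j ∈ Finset.range (J + 1), ((laurentD ψ y ^ j) (F j)).coeff n, ?_, ?_⟩
  · have ht (m : ℤ) := hasFinSum_taylor hy (coeff i (phi ψ m)) s c a m
    have hφ (m : ℤ) (r : ℕ) : coeff i (phiDerivZero ψ m r) =
        constantCoeff ((PowerSeries.derivative K)^[r] (coeff i (phi ψ m))) := by
      rw [phiDerivZero, coeff_map, coeff_iterate_dy]
    -- For fixed `m` the sum over `r` is the Taylor expansion; the remaining sum over `m` is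
    -- Lagrange inversion for each `j ≤ J`.
    refine HasFinSum.prod (g := fun m : ℤ => ∑ j ∈ Finset.range (J + 1),
      (m : K) ^ j * (seriesX ψ y ^ m).coeff n *
        (seriesX ψ y ^ (-m) * seriesQ ψ y * F j).coeff 0) ?_ (fun m => ?_)
      (HasFinSum.sum _ fun j _ => hasFinSum_lagrange hψ hy j n (F j))
    -- `m ≤ n` because `Xᵐ` starts at `zᵐ`; `m ≥ a` because `e^{uy} z^a` starts at `z^a`; then `r ≤
    -- s + (m - a)`, since `y` has no constant term.
    · refine ((Finset.Icc a n ×ˢ Finset.range (s + ((n - a).toNat + 1))).finite_toSet).subset ?_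
      rintro ⟨m, r⟩ hp
      by_contra hmr
      apply hp
      simp only [Finset.coe_product, Set.mem_prod, Finset.coe_Icc, Set.mem_Icc, Finset.coe_range,
        Set.mem_Iio] at hmr
      simp only [lhsCoeff]
      by_cases h1 : n < m
      · rw [coeff_seriesX_zpow hψ hy m n h1, mul_zero]
      · by_cases h2 : m < a
        · rw [HahnSeries.coeff_mul_single,
            show (expUY y).coeff (m - a) = 0 from coeff_ofPowerSeries_of_neg _ _ (by omega)]
          simp
        · rw [(ht m).1 r (by rw [Finset.mem_range]; omega), mul_zero, zero_mul]
    · convert (ht m).2.mul_right ((seriesX ψ y ^ m).coeff n) using 1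
      · funext r
        simp only [lhsCoeff, hφ]
      · rw [coeff_subst_iterate_derivative_phi hψ hy hJ, Finset.mul_sum, Finset.sum_mul]
        refine Finset.sum_congr rfl fun j _ => ?_
        have e : seriesX ψ y ^ (-m) * seriesQ ψ y * F j = HahnSeries.C c * (seriesX ψ y ^ (-m) *
            (HahnSeries.ofPowerSeries ℤ K (subst y (coeffVL ψ s i j)) *
              HahnSeries.single a 1)) := by
          have e1 : HahnSeries.single a c = HahnSeries.C c * HahnSeries.single a (1 : K) := by
            rw [HahnSeries.C_apply, HahnSeries.single_mul_single, zero_add, mul_one]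
          simp only [hF, e1]
          field_simp
        rw [e, coeff_C_mul_apply]
        ring
  · have hmap (r : ℕ) : HahnSeries.map (HahnSeries.single a (Polynomial.monomial s c))
        (Polynomial.lcoeff K r) = if r = s then HahnSeries.single a c else 0 := by
      ext b
      rw [HahnSeries.map_coeff, HahnSeries.coeff_single]
      split_ifs with h1 h2 h2 <;> simp_all [Polynomial.coeff_monomial, eq_comm]
    -- Only `r = s` survives in `[u^r]`, and only `j ≤ J` by the degree bound.
    convert hasFinSum_of_finset (Finset.range (J + 1) ×ˢ {s}) ?_ using 1
    · rw [Finset.sum_product]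
      refine Finset.sum_congr rfl fun j _ => ?_
      rw [Finset.sum_singleton, rhsCoeff, hmap, if_pos rfl]
    · rintro ⟨j, r⟩ h
      rw [rhsCoeff, hmap]
      split_ifs with hr
      · simp only at hr
        subst hr
        have : coeffVL ψ r i j = 0 := by
          ext k
          rw [coeffVL, coeff_mk, map_zero]
          exact Polynomial.coeff_eq_zero_of_natDegree_lt ((hJ k).trans_lt (by
            simpa [Nat.lt_succ_iff] using h))
        simp only [this]
        rw [← coe_substAlgHom (HasSubst.of_constantCoeff_zero' hy), map_zero, map_zero, zero_mul,
          zero_mul, map_zero, HahnSeries.coeff_zero]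
      · rw [mul_zero, map_zero, HahnSeries.coeff_zero]

/-- No operation on either side lowers the order in `z`, so a series starting beyond `z^n`
contributes nothing to `z^n`. -/
theorem hasFinSum_zero_of_coeff_eq_zero (hψ : constantCoeff ψ = 0) (hy : constantCoeff y = 0) (i : ℕ)
    {n : ℤ} {G : LaurentSeries (Polynomial K)} (hG : ∀ a < n + 1, G.coeff a = 0) :
    HasFinSum (lhsCoeff ψ y i n G) 0 ∧ HasFinSum (rhsCoeff ψ y i n G) 0 := by
  constructor
  · convert hasFinSum_zero using 2 with p
    rw [lhsCoeff]
    by_cases h : n < p.1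
    · rw [coeff_seriesX_zpow hψ hy _ _ h, mul_zero]
    · have : (expUY y * G).coeff p.1 = 0 := by
        rw [HahnSeries.coeff_mul]
        refine Finset.sum_eq_zero fun q hq => ?_
        rw [Finset.mem_antidiagonal] at hq
        by_cases h' : q.1 < 0
        · rw [show (expUY y).coeff q.1 = 0 from coeff_ofPowerSeries_of_neg _ _ h', zero_mul]
        · rw [hG _ (by omega), mul_zero]
      rw [this, Polynomial.coeff_zero, mul_zero, zero_mul]
  · convert hasFinSum_zero using 2 with p
    rw [rhsCoeff]
    refine coeff_laurentD_pow hψ hy (N := 0 + 0 + (n + 1)) ?_ _ n (by omega)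
    refine coeff_mul_eq_zero_of_lt (coeff_mul_eq_zero_of_lt (coeff_ofPowerSeries_of_neg _)
      (coeff_seriesQ_inv hψ hy)) fun a ha => ?_
    rw [HahnSeries.map_coeff, hG a ha, map_zero]

theorem sumsAgree (hψ : constantCoeff ψ = 0) (hy : constantCoeff y = 0) (i : ℕ) (n : ℤ)
    (G : LaurentSeries (Polynomial K)) : SumsAgree ψ y i n G := by
  have hp (a : ℤ) (p : Polynomial K) : SumsAgree ψ y i n (HahnSeries.single a p) := by
    induction p using Polynomial.induction_on' with
    | add p q hp hq => rw [HahnSeries.single_add]; exact hp.add hq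
    | monomial s c => exact sumsAgree_single hψ hy i n a s c
  -- Induction on the number of exponents up to `n` at which `G` may be non-zero, removing the
  -- lowest term each time.
  have key (d : ℕ) : ∀ G : LaurentSeries (Polynomial K), (∀ a < n + 1 - d, G.coeff a = 0) →
      SumsAgree ψ y i n G := by
    induction d with
    | zero =>
      intro G hG
      exact ⟨0, hasFinSum_zero_of_coeff_eq_zero hψ hy i fun a ha => hG a (by simpa using ha)⟩
    | succ d ih =>
      intro G hG
      set b : ℤ := n + 1 - (d + 1 : ℕ) with hb
      rw [← sub_add_cancel G (HahnSeries.single b (G.coeff b))]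
      refine (ih _ fun a ha => ?_).add (hp b _)
      rw [HahnSeries.coeff_sub, HahnSeries.coeff_single]
      split_ifs with h
      · rw [h, sub_self]
      · rw [hG a (by push_cast at hb; omega), sub_zero]
  refine key (n + 1 - G.order).toNat G fun i hi => HahnSeries.coeff_eq_zero_of_lt_order ?_
  have := Int.self_le_toNat (n + 1 - G.order)
  omega

theorem coeff_coeff_lhsTerm (H : PowerSeries (LaurentSeries (Polynomial K))) (m : ℤ) (r k : ℕ)
    (n : ℤ) : (coeff k (lhsTerm ψ y H m r)).coeff n =
      ∑ q ∈ Finset.HasAntidiagonal.antidiagonal k, lhsCoeff ψ y q.1 n (coeff q.2 H) (m, r) := by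
  rw [lhsTerm, coeff_mul_C, coeff_map, coeff_C_mul_apply, coeff_mul, Finset.sum_mul]
  refine Finset.sum_congr rfl fun q _ => ?_
  rw [lhsCoeff, coeffZU, coeff_mk, coeff_C_mul]

theorem coeff_iterate_opD (f : PowerSeries (LaurentSeries K)) (j k : ℕ) :
    coeff k ((opD ψ y)^[j] f) = (laurentD ψ y ^ j) (coeff k f) := by
  induction j with
  | zero => rfl
  | succ j ih =>
    rw [Function.iterate_succ_apply', laurentD_pow_succ_apply, ← ih, opD, coeff_mk, eulerOp_apply]

theorem coeff_coeff_rhsTerm (H : PowerSeries (LaurentSeries (Polynomial K))) (j r k : ℕ)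
    (n : ℤ) : (coeff k (rhsTerm ψ y H j r)).coeff n =
      ∑ q ∈ Finset.HasAntidiagonal.antidiagonal k, rhsCoeff ψ y q.1 n (coeff q.2 H) (j, r) := by
  rw [rhsTerm, coeff_iterate_opD, coeff_mul, map_sum, HahnSeries.coeff_sum]
  refine Finset.sum_congr rfl fun q _ => ?_
  rw [rhsCoeff, coeff_mul_C, coeffL, coeffU, coeff_mk, coeff_mk, coeffVL]

end Main

end

end PrincipalIdentity

theorem proposition3p3 {K : Type*} [Field K] [CharZero K]
    (ψ y : PowerSeries K)
    (hψ : PowerSeries.constantCoeff ψ = 0) (hy : PowerSeries.constantCoeff y = 0)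
    (H : PowerSeries (LaurentSeries (Polynomial K))) :
    ∃ F : PowerSeries (LaurentSeries K),
      PrincipalIdentity.HasFormalSum
        (fun p : ℤ × ℕ => PrincipalIdentity.lhsTerm ψ y H p.1 p.2) F ∧
      PrincipalIdentity.HasFormalSum
        (fun p : ℕ × ℕ => PrincipalIdentity.rhsTerm ψ y H p.1 p.2) F := by
  choose s hl hr using fun (i : ℕ) (n : ℤ) (G : LaurentSeries (Polynomial K)) =>
    PrincipalIdentity.sumsAgree hψ hy i n G
  let f (k : ℕ) (n : ℤ) : K :=
    ∑ q ∈ Finset.HasAntidiagonal.antidiagonal k, s q.1 n (PowerSeries.coeff q.2 H)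
  -- The common sums must assemble to a Laurent series for each `ħ^k`. Only `[ħ^i] H` with `i ≤ k`
  -- enters, so a lower bound `M` for these finitely many orders works.
  have hf (k : ℕ) : BddBelow (Function.support (f k)) := by
    obtain ⟨M, hM⟩ := ((Finset.HasAntidiagonal.antidiagonal k).image
      fun q : ℕ × ℕ => (PowerSeries.coeff q.2 H).order).bddBelow
    refine ⟨M, fun n hn => ?_⟩
    by_contra hlt
    refine hn (Finset.sum_eq_zero fun q hq => ?_)
    have h0 := (PrincipalIdentity.hasFinSum_zero_of_coeff_eq_zero hψ hy q.1 (n := n)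
      (G := PowerSeries.coeff q.2 H) fun a ha => HahnSeries.coeff_eq_zero_of_lt_order
        (lt_of_lt_of_le (by omega) (hM (Finset.mem_coe.2 (Finset.mem_image_of_mem _ hq))))).1
    -- The chosen value `s` is the sum of the same family, hence zero.
    exact (hl q.1 n _).2.symm.trans h0.2
  refine ⟨PowerSeries.mk fun k => HahnSeries.ofSuppBddBelow (f k) (hf k), fun k n => ?_,
    fun k n => ?_⟩ <;> rw [PowerSeries.coeff_mk]
  · simp only [PrincipalIdentity.coeff_coeff_lhsTerm]
    exact PrincipalIdentity.HasFinSum.sum _ fun q _ => hl q.1 n (PowerSeries.coeff q.2 H)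
  · simp only [PrincipalIdentity.coeff_coeff_rhsTerm]
    exact PrincipalIdentity.HasFinSum.sum _ fun q _ => hr q.1 n (PowerSeries.coeff q.2 H)
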